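/- Let $\mathcal X$ be the linear space of all (real- or complex-valued) measurable functions on $(0,\infty)$ with Lebesgue measure $m$, modulo equality almost everywhere. Let $L_0\subset\mathcal X$ be the space of functions whose support has finite measure, and let $L_r$, $0<r\le\infty$, be the usual Lebesgue spaces on $(0,\infty)$ with (quasi-)norm $\|\cdot\|_r$. For a linear operator $T:\mathcal X\to\mathcal X$ put $$\|T\|_{L_0\to L_0}=\sup_{x\in L_0}\frac{m(\operatorname{supp}(Tx))}{m(\operatorname{supp}(x))},\qquad \|T\|_{L_r\to L_r}=\sup_{x\in L_r}\frac{\|Tx\|_r}{\|x\|_r}\quad(0<r\le\infty),$$ with $0/0=0$ and $\|y\|_r=\infty$ if $y\notin L_r$. Let $\mu(t,u)=\inf\{s\ge 0: m(\{|u|>s\})\le t\}$, $t>0$, be the right-continuous decreasing rearrangement $\mu(u)$ of $u$. Tail majorization $v\prec\prec_{tl}u$ means $\int_t^\infty\mu(s,v)\,ds\le\int_t^\infty\mu(s,u)\,ds$ for all $t>0$, and head majorization $v\prec\prec_{hd}u$ means $\int_0^t\mu(s,v)\,ds\le\int_0^t\mu(s,u)\,ds$ for all $t>0$. (a) Let $0<q<\infty$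 and let $f,g\in L_0+L_q$ be such that $f=\mu(f)$, $g=\mu(g)$ and $|g|^q\prec\prec_{tl}|f|^q$. Then there is a linear operator $T:\mathcal X\to\mathcal X$ such that $Tf=g$ and $$\|T\|_{L_0\to L_0}\le 4,\qquad \|T\|_{L_q\to L_q}\le 2\cdot 3^{1/q}.$$ (b) Let $0<p<\infty$ and let $f,g\in L_p+L_\infty$ be such that $f=\mu(f)$, $g=\mu(g)$ and $|g|^p\prec\prec_{hd}|f|^p$. Then there is a linear operator $T:\mathcal X\to\mathcal X$ such that $Tf=g$ and $$\|T\|_{L_p\to L_p}\le 2\cdot 3^{1/p},\qquad \|T\|_{L_\infty\to L_\infty}\le 2\cdot 2^{1/p}.$$ -/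

import Mathlib

open MeasureTheory Set
open scoped ENNReal

noncomputable section

namespace HeadTail

/-- Lebesgue measure on the half-line `(0, ∞)`. -/
def halfLine : Measure ℝ := volume.restrict (Ioi 0)

/-- The linear space of all measurable scalar functions on `(0, ∞)`, modulo equality almost
everywhere. -/
abbrev X (𝕜 : Type*) [RCLike 𝕜] : Type _ := ℝ →ₘ[halfLine] 𝕜

/-- The measure of the support of a function on `(0, ∞)`. -/
def suppMeasure {𝕜 : Type*} [RCLike 𝕜] (f : X 𝕜) : ℝ≥0∞ := halfLine {t | f t ≠ 0}

/-- The space `L_0(0, ∞)` of functions whose support has finite measure. -/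
def LZero (𝕜 : Type*) [RCLike 𝕜] : AddSubgroup (X 𝕜) where
  carrier := {f | suppMeasure f < ∞}
  zero_mem' := by
    have h : suppMeasure (0 : X 𝕜) = 0 := by
      have h0 : ∀ᵐ t ∂halfLine, (0 : X 𝕜) t = 0 := AEEqFun.coeFn_zero
      exact ae_iff.1 h0
    simp [h]
  add_mem' := by
    intro f g hf hg
    have h : suppMeasure (f + g) ≤ suppMeasure f + suppMeasure g := by
      refine le_trans (measure_mono_ae ?_)
        (measure_union_le {t | f t ≠ 0} {t | g t ≠ 0})
      filter_upwards [AEEqFun.coeFn_add f g] with t ht hne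
      by_contra hcon
      have h2 : f t = 0 ∧ g t = 0 := by
        constructor
        · by_contra h; exact hcon (Or.inl h)
        · by_contra h; exact hcon (Or.inr h)
      exact hne (by simp [ht, h2.1, h2.2])
    exact lt_of_le_of_lt h (ENNReal.add_lt_top.2 ⟨hf, hg⟩)
  neg_mem' := by
    intro f hf
    have h : suppMeasure (-f) ≤ suppMeasure f := by
      refine measure_mono_ae ?_
      filter_upwards [AEEqFun.coeFn_neg f] with t ht hne h0
      exact hne (by simp [ht, h0])
    exact lt_of_le_of_lt h hf

/-- The space `L_r(0, ∞)` for `0 < r ≤ ∞`. -/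
abbrev LSpace (𝕜 : Type*) [RCLike 𝕜] (r : ℝ≥0∞) : AddSubgroup (X 𝕜) := Lp 𝕜 r halfLine

/-- The right-continuous decreasing rearrangement
`μ(t, u) = inf {s ≥ 0 : m({|u| > s}) ≤ t}` of a function `u` on `(0, ∞)`. -/
def rearr {E : Type*} [NormedAddCommGroup E] (u : ℝ → E) (t : ℝ) : ℝ≥0∞ :=
  sInf {s : ℝ≥0∞ | halfLine {x | s < ‖u x‖ₑ} ≤ ENNReal.ofReal t}

/-- `f = μ(f)`: the function `f` coincides with its own decreasing rearrangement. -/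
def IsOwnRearr {𝕜 : Type*} [RCLike 𝕜] (f : X 𝕜) : Prop :=
  ∀ᵐ t ∂halfLine, f t = (((rearr f t).toReal : ℝ) : 𝕜)

/-- Head majorization of `v` by `u`:
`∫_0^t μ(s, v) ds ≤ ∫_0^t μ(s, u) ds` for all `t > 0`. -/
def HeadMajorized (v u : ℝ → ℝ) : Prop :=
  ∀ t : ℝ, 0 < t → ∫⁻ s in Ioc 0 t, rearr v s ≤ ∫⁻ s in Ioc 0 t, rearr u s

/-- Tail majorization of `v` by `u`:
`∫_t^∞ μ(s, v) ds ≤ ∫_t^∞ μ(s, u) ds` for all `t > 0`. -/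
def TailMajorized (v u : ℝ → ℝ) : Prop :=
  ∀ t : ℝ, 0 < t → ∫⁻ s in Ioi t, rearr v s ≤ ∫⁻ s in Ioi t, rearr u s

/-- `‖T‖_{L_0 → L_0} = sup_{x ∈ L_0} m(supp (T x)) / m(supp x)` (with `0 / 0 = 0`). -/
def opNormLZero {𝕜 : Type*} [RCLike 𝕜] (T : X 𝕜 →ₗ[𝕜] X 𝕜) : ℝ≥0∞ :=
  ⨆ x : LZero 𝕜, suppMeasure (T (x : X 𝕜)) / suppMeasure (x : X 𝕜)

/-- `‖T‖_{L_r → L_r} = sup_{x ∈ L_r} ‖T x‖_r / ‖x‖_r` (with `0 / 0 = 0`), where `‖T x‖_r = ∞`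
if `T x` is not in `L_r`; so a finite value means that `T` maps `L_r` to itself boundedly. -/
def opNormL {𝕜 : Type*} [RCLike 𝕜] (r : ℝ≥0∞) (T : X 𝕜 →ₗ[𝕜] X 𝕜) : ℝ≥0∞ :=
  ⨆ x : LSpace 𝕜 r, eLpNorm (T (x : X 𝕜)) r halfLine / eLpNorm (x : X 𝕜) r halfLine

end HeadTail

end

/-!
Put `u = μ(f) ^ r` and `v = μ(g) ^ r`. There is a monotone `ψ` with `∫_{ψ t}^∞ u = ∫_t^∞ v` in the
tail case, and with `2 ∫_0^{ψ t} u = ∫_0^t v` in the head case. The operator is `T x = w • (x ∘ ψ)`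
with `w = μ(g) / (μ(f) ∘ ψ)`, so that `T f = g`.

Differentiating the matched integrals gives `v ≤ c * (u ∘ ψ) * ψ'` almost everywhere, that is
`w ^ r ≤ c * ψ'`, and the change of variables `s = ψ t` bounds `T` on `L_r`. In the head case
`ψ t ≤ t`, and the factor `2` puts at least half of `∫_0^t u` in `(ψ t, t]`, so that
`t * v t ≤ ∫_0^t v ≤ 2 * t * u (ψ t)`, which bounds `w`. In the tail case `t ≤ ψ t`, and `ψ` is kept
only where `u ∘ ψ ≤ v`: there `w ≥ 1`, so the change of variables also controls the measure of the
support. Elsewhere `v < u ∘ ψ ≤ u`, and `ψ` is replaced by the identity.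
-/

namespace HeadTail

open Filter Topology

section SetLIntegral

theorem tendsto_setLIntegral_of_ae_tendsto_indicator {α ι : Type*} [MeasurableSpace α]
    {μ : Measure α} {u : α → ℝ≥0∞} (L : Filter ι) [L.IsCountablyGenerated] {A B : Set α}
    {As : ι → Set α} (hA : MeasurableSet A) (hAs : ∀ i, MeasurableSet (As i))
    (hB : MeasurableSet B) (hfin : ∫⁻ x in B, u x ∂μ ≠ ∞) (hsub : ∀ᶠ i in L, As i ⊆ B)
    (hlim : ∀ᵐ x ∂μ, ∀ᶠ i in L, x ∈ As i ↔ x ∈ A) :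
    Tendsto (fun i => ∫⁻ x in As i, u x ∂μ) L (𝓝 (∫⁻ x in A, u x ∂μ)) := by
  simp only [← withDensity_apply u hA, ← withDensity_apply u (hAs _),
    ← withDensity_apply u hB] at hfin ⊢
  exact tendsto_measure_of_ae_tendsto_indicator L hA hAs hB hfin hsub
    (withDensity_absolutelyContinuous μ u hlim)

variable {u v : ℝ → ℝ≥0∞} {a b c : ℝ} {μ : Measure ℝ}

theorem exists_setLIntegral_Ioc_eq [NullSingletonClass μ] (hab : a ≤ b)
    (hfin : ∫⁻ x in Ioc a b, u x ∂μ ≠ ∞) {y : ℝ≥0∞} (hy : y ≤ ∫⁻ x in Ioc a b, u x ∂μ) :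
    ∃ s ∈ Icc a b, ∫⁻ x in Ioc a s, u x ∂μ = y := by
  have hcont : ContinuousOn (fun s => ∫⁻ x in Ioc a s, u x ∂μ) (Icc a b) := fun s _ => by
    refine tendsto_setLIntegral_of_ae_tendsto_indicator _ measurableSet_Ioc
      (fun _ => measurableSet_Ioc) measurableSet_Ioc hfin ?_ ?_
    · filter_upwards [self_mem_nhdsWithin] with r hr using Ioc_subset_Ioc_right hr.2
    · filter_upwards [Measure.ae_ne μ s] with x hx
      refine eventually_nhdsWithin_of_eventually_nhds ?_
      rcases hx.lt_or_gt with h | h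
      · filter_upwards [lt_mem_nhds h] with r hr
        simp only [mem_Ioc, hr.le, h.le]
      · filter_upwards [gt_mem_nhds h] with r hr
        simp only [mem_Ioc, hr.not_ge, h.not_ge]
  exact intermediate_value_Icc hab hcont ⟨by simp, hy⟩

theorem exists_setLIntegral_Ioi_eq [NullSingletonClass μ]
    (hfin : ∫⁻ x in Ioi a, u x ∂μ ≠ ∞) {y : ℝ≥0∞} (hy0 : 0 < y)
    (hy : y ≤ ∫⁻ x in Ioi a, u x ∂μ) : ∃ s, a ≤ s ∧ ∫⁻ x in Ioi s, u x ∂μ = y := by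
  have hcont : ContinuousOn (fun s => ∫⁻ x in Ioi s, u x ∂μ) (Ici a) := fun s _ => by
    refine tendsto_setLIntegral_of_ae_tendsto_indicator _ measurableSet_Ioi
      (fun _ => measurableSet_Ioi) measurableSet_Ioi hfin ?_ ?_
    · filter_upwards [self_mem_nhdsWithin] with r hr using Ioi_subset_Ioi hr
    · filter_upwards [Measure.ae_ne μ s] with x hx
      refine eventually_nhdsWithin_of_eventually_nhds ?_
      rcases hx.lt_or_gt with h | h
      · filter_upwards [lt_mem_nhds h] with r hr
        simp only [mem_Ioi, hr.not_gt, h.not_gt]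
      · filter_upwards [gt_mem_nhds h] with r hr
        simp only [mem_Ioi, hr, h]
  have hlim : Tendsto (fun s => ∫⁻ x in Ioi s, u x ∂μ) atTop (𝓝 0) := by
    have := tendsto_setLIntegral_of_ae_tendsto_indicator (μ := μ) (u := u) atTop
      MeasurableSet.empty (fun s : ℝ => measurableSet_Ioi) measurableSet_Ioi hfin
      ((eventually_ge_atTop a).mono fun s hs => Ioi_subset_Ioi hs)
      (Eventually.of_forall fun x => (eventually_ge_atTop x).mono fun s hs => by
        simp only [mem_Ioi, hs.not_gt, mem_empty_iff_false])
    simpa only [Measure.restrict_empty, lintegral_zero_measure] using this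
  exact isPreconnected_Ici.intermediate_value_Ioc self_mem_Ici
    (le_principal_iff.2 (Ici_mem_atTop a)) hcont hlim ⟨hy0, hy⟩

theorem setLIntegral_Ioc_add_Ioc (hab : a ≤ b) (hbc : b ≤ c) :
    (∫⁻ x in Ioc a b, u x ∂μ) + ∫⁻ x in Ioc b c, u x ∂μ = ∫⁻ x in Ioc a c, u x ∂μ := by
  rw [← lintegral_union measurableSet_Ioc (Ioc_disjoint_Ioc_of_le le_rfl),
    Ioc_union_Ioc_eq_Ioc hab hbc]

theorem setLIntegral_Ioc_add_Ioi (hab : a ≤ b) :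
    (∫⁻ x in Ioc a b, u x ∂μ) + ∫⁻ x in Ioi b, u x ∂μ = ∫⁻ x in Ioi a, u x ∂μ := by
  rw [← lintegral_union measurableSet_Ioi Ioc_disjoint_Ioi_same, Ioc_union_Ioi_eq_Ioi hab]

theorem setLIntegral_Ioc_le_mul (hu : Antitone u) (a b : ℝ) :
    ∫⁻ x in Ioc a b, u x ≤ ENNReal.ofReal (b - a) * u a := by
  refine (setLIntegral_mono measurable_const fun x hx => hu hx.1.le).trans ?_
  rw [setLIntegral_const, Real.volume_Ioc, mul_comm]

theorem mul_le_setLIntegral_Ioc (hv : Antitone v) (a b : ℝ) :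
    ENNReal.ofReal (b - a) * v b ≤ ∫⁻ x in Ioc a b, v x := by
  refine le_trans ?_ (setLIntegral_mono hv.measurable fun x hx => hv hx.2)
  rw [setLIntegral_const, Real.volume_Ioc, mul_comm]

theorem setLIntegral_Ioc_ne_zero (hv : Antitone v) (hab : a < b) (hvb : v b ≠ 0) :
    ∫⁻ x in Ioc a b, v x ≠ 0 :=
  (lt_of_lt_of_le (ENNReal.mul_pos (by simpa using hab) hvb) (mul_le_setLIntegral_Ioc hv a b)).ne'

end SetLIntegral

section MonotoneChangeOfVariables

theorem le_mul_ofReal_of_hasDerivWithinAt {v : ℝ → ℝ≥0∞} {φ : ℝ → ℝ} {φ' t : ℝ} {C : ℝ≥0∞}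
    (hC : C ≠ ∞) (hv : ContinuousWithinAt v (Ioi t) t) (hφ : HasDerivWithinAt φ φ' (Ioi t) t)
    (h : ∀ᶠ s in 𝓝[>] t, ENNReal.ofReal (s - t) * v s ≤ C * ENNReal.ofReal (φ s - φ t)) :
    v t ≤ C * ENNReal.ofReal φ' := by
  rw [hasDerivWithinAt_iff_tendsto_slope' self_notMem_Ioi] at hφ
  refine le_of_tendsto_of_tendsto hv
    (ENNReal.Tendsto.const_mul (ENNReal.tendsto_ofReal hφ) (Or.inr hC)) ?_
  filter_upwards [h, self_mem_nhdsWithin] with s hs hts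
  have hpos : 0 < s - t := sub_pos.2 hts
  rw [slope_def_field, ENNReal.ofReal_div_of_pos hpos, ← mul_div_assoc,
    ENNReal.le_div_iff_mul_le (Or.inl (by simpa using hpos)) (Or.inl ENNReal.ofReal_ne_top),
    mul_comm]
  exact hs

variable {u v : ℝ → ℝ≥0∞} {φ : ℝ → ℝ} {P S : Set ℝ} {c : ℝ≥0∞}

theorem ae_continuousAt_of_antitone (hv : Antitone v) : ∀ᵐ t, ContinuousAt v t := by
  simpa only [mem_ofPred_eq, not_not] using hv.countable_not_continuousAt.ae_notMem volume

theorem div_comp_le_mul_deriv (hu : Antitone u) (hv : Antitone v) (hP : IsOpen P) (hc : c ≠ ∞)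
    (hle : ∀ s ∈ P, ∀ t ∈ P, s ≤ t →
      ∫⁻ x in Ioc s t, v x ≤ c * ∫⁻ x in Ioc (φ s) (φ t), u x)
    {t : ℝ} (ht : t ∈ P) (hvt : ContinuousAt v t) (hφt : DifferentiableAt ℝ φ t) :
    v t / u (φ t) ≤ c * ENNReal.ofReal (deriv φ t) := by
  rcases eq_or_ne (u (φ t)) ∞ with htop | htop
  · simp [htop]
  refine ENNReal.div_le_of_le_mul ?_
  rw [mul_right_comm]
  refine le_mul_ofReal_of_hasDerivWithinAt (ENNReal.mul_ne_top hc htop) hvt.continuousWithinAt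
    hφt.hasDerivAt.hasDerivWithinAt ?_
  filter_upwards [nhdsWithin_le_nhds (hP.mem_nhds ht), self_mem_nhdsWithin] with s hs hts
  calc ENNReal.ofReal (s - t) * v s ≤ ∫⁻ x in Ioc t s, v x := mul_le_setLIntegral_Ioc hv t s
    _ ≤ c * ∫⁻ x in Ioc (φ t) (φ s), u x := hle t ht s hs (le_of_lt hts)
    _ ≤ c * (ENNReal.ofReal (φ s - φ t) * u (φ t)) := by
        gcongr
        exact setLIntegral_Ioc_le_mul hu _ _
    _ = c * u (φ t) * ENNReal.ofReal (φ s - φ t) := by ring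

theorem setLIntegral_div_comp_le_volume_image (hu : Antitone u) (hv : Antitone v)
    (hP : IsOpen P) (hφ : MonotoneOn φ P) (hc : c ≠ ∞)
    (hle : ∀ s ∈ P, ∀ t ∈ P, s ≤ t →
      ∫⁻ x in Ioc s t, v x ≤ c * ∫⁻ x in Ioc (φ s) (φ t), u x)
    (hS : MeasurableSet S) (hSP : S ⊆ P) :
    ∫⁻ t in S, v t / u (φ t) ≤ c * volume (φ '' S) := by
  set D : Set ℝ := {t | DifferentiableAt ℝ φ t}
  have hD : MeasurableSet D := measurableSet_of_differentiableAt ℝ φ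
  have hSD : (S ∩ D : Set ℝ) =ᵐ[volume] S := by
    filter_upwards [hφ.ae_differentiableWithinAt_of_mem] with t ht
    refine propext ⟨fun h => h.1, fun h => ⟨h, ?_⟩⟩
    exact (ht (hSP h)).differentiableAt (hP.mem_nhds (hSP h))
  calc ∫⁻ t in S, v t / u (φ t)
      = ∫⁻ t in S ∩ D, v t / u (φ t) := (setLIntegral_congr hSD).symm
    _ ≤ ∫⁻ t in S ∩ D, c * ENNReal.ofReal (deriv φ t) := by
        refine setLIntegral_mono_ae' (hS.inter hD) ?_
        filter_upwards [ae_continuousAt_of_antitone hv] with t hvt ht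
        exact div_comp_le_mul_deriv hu hv hP hc hle (hSP ht.1) hvt ht.2
    _ = c * ∫⁻ t in S ∩ D, ENNReal.ofReal (deriv φ t) := lintegral_const_mul' _ _ hc
    _ = c * volume (φ '' (S ∩ D)) := by
        rw [lintegral_deriv_eq_volume_image_of_monotoneOn (hS.inter hD)
          (fun t ht => ht.2.hasDerivAt.hasDerivWithinAt)
          (hφ.mono (inter_subset_left.trans hSP))]
    _ ≤ c * volume (φ '' S) := by gcongr; exact inter_subset_left

end MonotoneChangeOfVariables

section SupportInterval

/-- For an antitone `v`, the open interval `(0, a)` on which `v` is nonzero, `a` being the right end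
of the support of `v`. It is open whether or not `v a = 0`, because of the strict `t < s`. -/
def supportInterval (v : ℝ → ℝ≥0∞) : Set ℝ := {t | 0 < t ∧ ∃ s, t < s ∧ v s ≠ 0}

variable {v : ℝ → ℝ≥0∞}

theorem supportInterval_subset_Ioi (v : ℝ → ℝ≥0∞) : supportInterval v ⊆ Ioi 0 := fun _ ht => ht.1

theorem isOpen_supportInterval (v : ℝ → ℝ≥0∞) : IsOpen (supportInterval v) := by
  have : supportInterval v = Ioi 0 ∩ ⋃ s ∈ {s | v s ≠ 0}, Iio s := by
    ext t
    simp [supportInterval, and_comm]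
  rw [this]
  exact isOpen_Ioi.inter (isOpen_biUnion fun _ _ => isOpen_Iio)

instance ordConnected_supportInterval (v : ℝ → ℝ≥0∞) : (supportInterval v).OrdConnected :=
  ⟨fun _ hx _ hy _ hz => ⟨hx.1.trans_le hz.1, hy.2.imp fun _ h => ⟨hz.2.trans_lt h.1, h.2⟩⟩⟩

theorem ne_zero_of_mem_supportInterval (hv : Antitone v) {t : ℝ} (ht : t ∈ supportInterval v) :
    v t ≠ 0 := by
  obtain ⟨-, s, hts, hs⟩ := ht
  exact fun h => hs (nonpos_iff_eq_zero.1 ((hv hts.le).trans h.le))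

theorem ae_eq_zero_of_notMem_supportInterval (hv : Antitone v) :
    ∀ᵐ t ∂halfLine, t ∉ supportInterval v → v t = 0 := by
  filter_upwards [ae_restrict_of_ae (ae_continuousAt_of_antitone hv),
    ae_restrict_mem measurableSet_Ioi] with t hvt ht
  contrapose!
  intro hne
  have hright : ∀ᶠ s in 𝓝[>] t, v s ≠ 0 := nhdsWithin_le_nhds (hvt.eventually_ne hne)
  obtain ⟨s, hvs, hts⟩ := (hright.and self_mem_nhdsWithin).exists
  exact ⟨ht, s, hts, hvs⟩

theorem setLIntegral_Ioi_ne_zero (hv : Antitone v) {t : ℝ} (ht : t ∈ supportInterval v) :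
    ∫⁻ x in Ioi t, v x ≠ 0 := by
  obtain ⟨-, s, hts, hs⟩ := ht
  refine fun h => setLIntegral_Ioc_ne_zero hv hts hs (nonpos_iff_eq_zero.1 ?_)
  exact (lintegral_mono_set Ioc_subset_Ioi_self).trans h.le

end SupportInterval

section Transport

theorem exists_measurable_monotoneOn {P : Set ℝ} [P.OrdConnected] {p : ℝ → ℝ → Prop}
    (hex : ∀ t ∈ P, ∃ s, p t s)
    (hmono : ∀ t₁ ∈ P, ∀ t₂ ∈ P, t₁ < t₂ → ∀ s₁ s₂, p t₁ s₁ → p t₂ s₂ → s₁ ≤ s₂) :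
    ∃ ψ : ℝ → ℝ, Measurable ψ ∧ MonotoneOn ψ P ∧ (∀ t ∈ P, p t (ψ t)) ∧ ∀ t ∉ P, ψ t = t := by
  classical
  choose! φ hφ using hex
  have hφmono : MonotoneOn φ P := fun s hs t ht hst => by
    rcases hst.eq_or_lt with rfl | hlt
    · rfl
    · exact hmono s hs t ht hlt _ _ (hφ s hs) (hφ t ht)
  have hEqOn : EqOn (P.piecewise φ id) φ P := piecewise_eqOn _ _ _
  refine ⟨P.piecewise φ id, ?_, hφmono.congr hEqOn.symm, fun t ht => hEqOn ht ▸ hφ t ht,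
    fun t ht => piecewise_eq_of_notMem _ _ _ ht⟩
  refine measurable_of_restrict_of_restrict_compl (OrdConnected.measurableSet ‹_›) ?_ ?_
  · rw [domRestrict_piecewise]
    have : Monotone (P.domRestrict φ) := fun s t hst => hφmono s.2 t.2 hst
    exact this.measurable
  · rw [domRestrict_piecewise_compl]
    exact measurable_subtype_coe

theorem halfLine_restrict {S : Set ℝ} (hS : S ⊆ Ioi 0) :
    halfLine.restrict S = volume.restrict S := by
  rw [halfLine, Measure.restrict_restrict_of_subset hS]

variable {u v : ℝ → ℝ≥0∞} {ψ : ℝ → ℝ} {P B : Set ℝ} {c : ℝ≥0∞}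

theorem setLIntegral_div_comp_le_halfLine (hu : Antitone u) (hv : Antitone v) (hP : IsOpen P)
    (hP0 : P ⊆ Ioi 0) (hψ : Measurable ψ) (hmono : MonotoneOn ψ P) (hmaps : MapsTo ψ P (Ioi 0))
    (hc : c ≠ ∞)
    (hle : ∀ s ∈ P, ∀ t ∈ P, s ≤ t →
      ∫⁻ x in Ioc s t, v x ≤ c * ∫⁻ x in Ioc (ψ s) (ψ t), u x)
    (hB : MeasurableSet B) :
    ∫⁻ t in P ∩ ψ ⁻¹' B, v t / u (ψ t) ∂halfLine ≤ c * halfLine B := by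
  rw [halfLine_restrict (inter_subset_left.trans hP0)]
  refine (setLIntegral_div_comp_le_volume_image hu hv hP hmono hc hle
    (hP.measurableSet.inter (hψ hB)) inter_subset_left).trans ?_
  rw [halfLine, Measure.restrict_apply hB]
  gcongr
  rintro _ ⟨t, ⟨htP, htB⟩, rfl⟩
  exact ⟨htB, hmaps htP⟩

end Transport

/-- `ψ` is a transport from `v` to `u` with constant `c`: the weight `v / (u ∘ ψ)` multiplies
`u ∘ ψ` to `v`, and the measure it defines on the half-line is pushed forward by `ψ` to at most `c`
times Lebesgue measure, so that `x ↦ (v / (u ∘ ψ)) • (x ∘ ψ)` has norm at most `c` on `L_1`. -/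
structure IsTransport (c : ℝ≥0∞) (u v : ℝ → ℝ≥0∞) (ψ : ℝ → ℝ) : Prop where
  measurable : Measurable ψ
  pos : ∀ t, 0 < t → 0 < ψ t
  ne_zero : ∀ᵐ t ∂halfLine, v t ≠ 0 → u (ψ t) ≠ 0
  map_le : (halfLine.withDensity fun t => v t / u (ψ t)).map ψ ≤ c • halfLine

theorem isTransport_of_monotoneOn {u v : ℝ → ℝ≥0∞} {ψ : ℝ → ℝ} {c : ℝ≥0∞} (hu : Antitone u)
    (hv : Antitone v) (hψ : Measurable ψ) (hmono : MonotoneOn ψ (supportInterval v))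
    (hpos : ∀ t, 0 < t → 0 < ψ t) (hne : ∀ t ∈ supportInterval v, u (ψ t) ≠ 0) (hc : c ≠ ∞)
    (hle : ∀ s ∈ supportInterval v, ∀ t ∈ supportInterval v, s ≤ t →
      ∫⁻ x in Ioc s t, v x ≤ c * ∫⁻ x in Ioc (ψ s) (ψ t), u x) :
    IsTransport c u v ψ := by
  have hP : MeasurableSet (supportInterval v) := (isOpen_supportInterval v).measurableSet
  refine ⟨hψ, hpos, ?_, Measure.le_iff.2 fun B hB => ?_⟩
  · filter_upwards [ae_eq_zero_of_notMem_supportInterval hv] with t ht hvt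
    exact hne t (not_imp_comm.1 ht hvt)
  · calc (halfLine.withDensity fun t => v t / u (ψ t)).map ψ B
        = ∫⁻ t in ψ ⁻¹' B, v t / u (ψ t) ∂halfLine := by
          rw [Measure.map_apply hψ hB, withDensity_apply _ (hψ hB)]
      _ = ∫⁻ t in supportInterval v ∩ ψ ⁻¹' B, v t / u (ψ t) ∂halfLine := by
          rw [← Measure.restrict_restrict hP, ← lintegral_indicator hP]
          refine lintegral_congr_ae (ae_restrict_of_ae ?_)
          filter_upwards [ae_eq_zero_of_notMem_supportInterval hv] with t ht
          by_cases htP : t ∈ supportInterval v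
          · simp [htP]
          · simp [htP, ht htP]
      _ ≤ (c • halfLine) B :=
          setLIntegral_div_comp_le_halfLine hu hv (isOpen_supportInterval v)
            (supportInterval_subset_Ioi v) hψ hmono (fun t ht => hpos t ht.1) hc hle hB

section Head

variable {u v : ℝ → ℝ≥0∞}

theorem exists_monotoneOn_setLIntegral_Ioc_eq (hv : Antitone v)
    (hfin : ∀ t, 0 < t → ∫⁻ s in Ioc 0 t, u s ≠ ∞)
    (hle : ∀ t, 0 < t → ∫⁻ s in Ioc 0 t, v s ≤ ∫⁻ s in Ioc 0 t, u s) :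
    ∃ ψ : ℝ → ℝ, Measurable ψ ∧ MonotoneOn ψ (supportInterval v) ∧
      (∀ t ∈ supportInterval v, ψ t ∈ Ioc 0 t ∧
        2 * ∫⁻ s in Ioc 0 (ψ t), u s = ∫⁻ s in Ioc 0 t, v s) ∧
      ∀ t ∉ supportInterval v, ψ t = t := by
  refine exists_measurable_monotoneOn (P := supportInterval v)
    (p := fun t s => s ∈ Ioc 0 t ∧ 2 * ∫⁻ x in Ioc 0 s, u x = ∫⁻ x in Ioc 0 t, v x)
    (fun t ht => ?_) fun t₁ h₁ t₂ h₂ hlt s₁ s₂ hs₁ hs₂ => ?_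
  · obtain ⟨s, hs, hsv⟩ := exists_setLIntegral_Ioc_eq ht.1.le (hfin t ht.1)
      (ENNReal.half_le_self.trans (hle t ht.1))
    have hmatch : 2 * ∫⁻ x in Ioc 0 s, u x = ∫⁻ x in Ioc 0 t, v x := by
      rw [hsv, ENNReal.mul_div_cancel two_ne_zero ENNReal.ofNat_ne_top]
    refine ⟨s, ⟨hs.1.lt_of_ne ?_, hs.2⟩, hmatch⟩
    rintro rfl
    exact setLIntegral_Ioc_ne_zero hv ht.1 (ne_zero_of_mem_supportInterval hv ht)
      (by simpa using hmatch.symm)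
  · by_contra! hlt'
    have hV : ∫⁻ x in Ioc 0 t₂, v x ≤ ∫⁻ x in Ioc 0 t₁, v x := by
      rw [← hs₁.2, ← hs₂.2]
      gcongr
    rw [← setLIntegral_Ioc_add_Ioc h₁.1.le hlt.le] at hV
    refine setLIntegral_Ioc_ne_zero hv hlt (ne_zero_of_mem_supportInterval hv h₂)
      (nonpos_iff_eq_zero.1 ?_)
    exact (ENNReal.add_le_add_iff_left (ne_top_of_le_ne_top (hfin t₁ h₁.1) (hle t₁ h₁.1))).1
      (hV.trans_eq (add_zero _).symm)

theorem le_two_mul_of_setLIntegral_Ioc_eq (hu : Antitone u) (hv : Antitone v) {s t : ℝ}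
    (hs : s ∈ Ioc 0 t) (hfin : ∫⁻ x in Ioc 0 t, u x ≠ ∞)
    (hle : ∫⁻ x in Ioc 0 t, v x ≤ ∫⁻ x in Ioc 0 t, u x)
    (hst : 2 * ∫⁻ x in Ioc 0 s, u x = ∫⁻ x in Ioc 0 t, v x) : v t ≤ 2 * u s := by
  have hsplit := setLIntegral_Ioc_add_Ioc (μ := volume) (u := u) hs.1.le hs.2
  have hhalf : ∫⁻ x in Ioc 0 s, u x ≤ ∫⁻ x in Ioc s t, u x := by
    rw [← hst, ← hsplit, two_mul] at hle
    rw [← hsplit] at hfin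
    exact (ENNReal.add_le_add_iff_left (ENNReal.add_ne_top.1 hfin).1).1 hle
  have ht : 0 < t := hs.1.trans_le hs.2
  refine (ENNReal.mul_le_mul_iff_right (by simpa using ht) (ENNReal.ofReal_ne_top (r := t))).1 ?_
  calc ENNReal.ofReal t * v t ≤ ∫⁻ x in Ioc 0 t, v x := by
        simpa using mul_le_setLIntegral_Ioc hv 0 t
    _ = 2 * ∫⁻ x in Ioc 0 s, u x := hst.symm
    _ ≤ 2 * (ENNReal.ofReal (t - s) * u s) := by
        gcongr
        exact hhalf.trans (setLIntegral_Ioc_le_mul hu s t)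
    _ ≤ 2 * (ENNReal.ofReal t * u s) := by
        gcongr
        linarith [hs.1]
    _ = ENNReal.ofReal t * (2 * u s) := by ring

theorem exists_isTransport_of_setLIntegral_Ioc_le (hu : Antitone u) (hv : Antitone v)
    (hfin : ∀ t, 0 < t → ∫⁻ s in Ioc 0 t, u s ≠ ∞)
    (hle : ∀ t, 0 < t → ∫⁻ s in Ioc 0 t, v s ≤ ∫⁻ s in Ioc 0 t, u s) :
    ∃ ψ, IsTransport 2 u v ψ ∧ ∀ᵐ t ∂halfLine, v t ≤ 2 * u (ψ t) := by
  obtain ⟨ψ, hψ, hmono, hmatch, hoff⟩ := exists_monotoneOn_setLIntegral_Ioc_eq hv hfin hle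
  have hpos : ∀ t, 0 < t → 0 < ψ t := fun t ht => by
    by_cases htP : t ∈ supportInterval v
    · exact (hmatch t htP).1.1
    · rwa [hoff t htP]
  have hbound : ∀ t ∈ supportInterval v, v t ≤ 2 * u (ψ t) := fun t ht =>
    le_two_mul_of_setLIntegral_Ioc_eq hu hv (hmatch t ht).1 (hfin t ht.1) (hle t ht.1)
      (hmatch t ht).2
  have hne : ∀ t ∈ supportInterval v, u (ψ t) ≠ 0 := fun t ht hut =>
    ne_zero_of_mem_supportInterval hv ht (by simpa [hut] using hbound t ht)
  have hincr : ∀ s ∈ supportInterval v, ∀ t ∈ supportInterval v, s ≤ t →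
      ∫⁻ x in Ioc s t, v x ≤ 2 * ∫⁻ x in Ioc (ψ s) (ψ t), u x := fun s hs t ht hst => by
    refine (ENNReal.add_le_add_iff_left
      (ne_top_of_le_ne_top (hfin s hs.1) (hle s hs.1))).1 (le_of_eq ?_)
    rw [setLIntegral_Ioc_add_Ioc hs.1.le hst, ← (hmatch s hs).2, ← mul_add,
      setLIntegral_Ioc_add_Ioc (hpos s hs.1).le (hmono hs ht hst), (hmatch t ht).2]
  refine ⟨ψ, isTransport_of_monotoneOn hu hv hψ hmono hpos hne ENNReal.ofNat_ne_top hincr, ?_⟩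
  filter_upwards [ae_eq_zero_of_notMem_supportInterval hv] with t ht
  by_cases htP : t ∈ supportInterval v
  · exact hbound t htP
  · simp [ht htP]

end Head

section Tail

variable {u v : ℝ → ℝ≥0∞}

theorem exists_monotoneOn_setLIntegral_Ioi_eq (hv : Antitone v)
    (hfin : ∀ t, 0 < t → ∫⁻ s in Ioi t, u s ≠ ∞)
    (hle : ∀ t, 0 < t → ∫⁻ s in Ioi t, v s ≤ ∫⁻ s in Ioi t, u s) :
    ∃ ψ : ℝ → ℝ, Measurable ψ ∧ MonotoneOn ψ (supportInterval v) ∧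
      (∀ t ∈ supportInterval v, t ≤ ψ t ∧
        ∫⁻ s in Ioi (ψ t), u s = ∫⁻ s in Ioi t, v s) ∧
      ∀ t ∉ supportInterval v, ψ t = t := by
  refine exists_measurable_monotoneOn (P := supportInterval v)
    (p := fun t s => t ≤ s ∧ ∫⁻ x in Ioi s, u x = ∫⁻ x in Ioi t, v x)
    (fun t ht => ?_) fun t₁ _ t₂ h₂ hlt s₁ s₂ hs₁ hs₂ => ?_
  · exact exists_setLIntegral_Ioi_eq (hfin t ht.1)
      (pos_iff_ne_zero.2 (setLIntegral_Ioi_ne_zero hv ht)) (hle t ht.1)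
  · by_contra! hlt'
    have hV : ∫⁻ x in Ioi t₁, v x ≤ ∫⁻ x in Ioi t₂, v x := by
      rw [← hs₁.2, ← hs₂.2]
      exact lintegral_mono_set (Ioi_subset_Ioi hlt'.le)
    rw [← setLIntegral_Ioc_add_Ioi hlt.le] at hV
    refine setLIntegral_Ioc_ne_zero hv hlt (ne_zero_of_mem_supportInterval hv h₂)
      (nonpos_iff_eq_zero.1 ?_)
    exact (ENNReal.add_le_add_iff_right (ne_top_of_le_ne_top (hfin t₂ h₂.1) (hle t₂ h₂.1))).1
      (hV.trans_eq (zero_add _).symm)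

theorem exists_isTransport_one_of_setLIntegral_Ioi_le (hu : Antitone u) (hv : Antitone v)
    (hfin : ∀ t, 0 < t → ∫⁻ s in Ioi t, u s ≠ ∞)
    (hle : ∀ t, 0 < t → ∫⁻ s in Ioi t, v s ≤ ∫⁻ s in Ioi t, u s) :
    ∃ ψ, IsTransport 1 u v ψ ∧ ∀ t, t ≤ ψ t := by
  obtain ⟨ψ, hψ, hmono, hmatch, hoff⟩ := exists_monotoneOn_setLIntegral_Ioi_eq hv hfin hle
  have hleψ : ∀ t, t ≤ ψ t := fun t => by
    by_cases htP : t ∈ supportInterval v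
    · exact (hmatch t htP).1
    · exact (hoff t htP).ge
  have hne : ∀ t ∈ supportInterval v, u (ψ t) ≠ 0 := fun t ht hut => by
    refine setLIntegral_Ioi_ne_zero hv ht ?_
    rw [← (hmatch t ht).2]
    refine setLIntegral_eq_zero measurableSet_Ioi fun s hs => ?_
    exact nonpos_iff_eq_zero.1 ((hu (le_of_lt hs)).trans hut.le)
  refine ⟨ψ, isTransport_of_monotoneOn hu hv hψ hmono (fun t ht => ht.trans_le (hleψ t)) hne
    ENNReal.one_ne_top fun s hs t ht hst => ?_, hleψ⟩
  refine (ENNReal.add_le_add_iff_right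
    (ne_top_of_le_ne_top (hfin t ht.1) (hle t ht.1))).1 (le_of_eq ?_)
  rw [setLIntegral_Ioc_add_Ioi hst, ← (hmatch t ht).2, one_mul,
    setLIntegral_Ioc_add_Ioi (hmono hs ht hst), (hmatch s hs).2]

variable {ψ : ℝ → ℝ} {c : ℝ≥0∞}

theorem IsTransport.map_withDensity_piecewise_le (h : IsTransport c u v ψ) {A : Set ℝ}
    [∀ t, Decidable (t ∈ A)] (hA : MeasurableSet A) {κ : ℝ → ℝ≥0∞}
    (hκA : ∀ᵐ t ∂halfLine, t ∈ A → κ t ≤ v t / u (ψ t))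
    (hκ : ∀ᵐ t ∂halfLine, t ∉ A → κ t ≤ 1) :
    (halfLine.withDensity κ).map (A.piecewise ψ id) ≤ (c + 1) • halfLine := by
  have hψA : Measurable (A.piecewise ψ id) := h.measurable.piecewise hA measurable_id
  refine Measure.le_iff.2 fun B hB => ?_
  have hon : ∫⁻ t in A.piecewise ψ id ⁻¹' B ∩ A, κ t ∂halfLine ≤ c * halfLine B := by
    calc ∫⁻ t in A.piecewise ψ id ⁻¹' B ∩ A, κ t ∂halfLine
        ≤ ∫⁻ t in A.piecewise ψ id ⁻¹' B ∩ A, v t / u (ψ t) ∂halfLine :=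
          setLIntegral_mono_ae' ((hψA hB).inter hA) (hκA.mono fun t ht htA => ht htA.2)
      _ ≤ ∫⁻ t in ψ ⁻¹' B, v t / u (ψ t) ∂halfLine := lintegral_mono_set fun t ht => by
          simpa [ht.2] using ht.1
      _ = (halfLine.withDensity fun t => v t / u (ψ t)).map ψ B := by
          rw [Measure.map_apply h.measurable hB, withDensity_apply _ (h.measurable hB)]
      _ ≤ c * halfLine B := h.map_le B
  have hoff : ∫⁻ t in A.piecewise ψ id ⁻¹' B \ A, κ t ∂halfLine ≤ halfLine B := by
    calc ∫⁻ t in A.piecewise ψ id ⁻¹' B \ A, κ t ∂halfLine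
        ≤ ∫⁻ _ in A.piecewise ψ id ⁻¹' B \ A, 1 ∂halfLine :=
          setLIntegral_mono_ae' ((hψA hB).diff hA) (hκ.mono fun t ht htA => ht htA.2)
      _ = halfLine (A.piecewise ψ id ⁻¹' B \ A) := setLIntegral_one _
      _ ≤ halfLine B := measure_mono fun t ht => by simpa [ht.2] using ht.1
  rw [Measure.map_apply hψA hB, withDensity_apply _ (hψA hB), ← lintegral_inter_add_sdiff _ _ hA,
    Measure.smul_apply, smul_eq_mul, add_mul, one_mul]
  exact add_le_add hon hoff

theorem IsTransport.exists_map_restrict_support_le (h : IsTransport c u v ψ) (hu : Antitone u)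
    (hutop : ∀ t, 0 < t → u t ≠ ∞) (hv : Measurable v) (hψ : ∀ t, t ≤ ψ t) :
    ∃ ψ', IsTransport (c + 1) u v ψ' ∧
      (halfLine.restrict (Function.support v)).map ψ' ≤ (c + 1) • halfLine := by
  classical
  set A : Set ℝ := {t | u (ψ t) ≤ v t}
  have hA : MeasurableSet A := measurableSet_le (hu.measurable.comp h.measurable) hv
  have hoff : ∀ t ∉ A, v t ≤ u t := fun t ht => (not_le.1 ht).le.trans (hu (hψ t))
  have hpiecewise : ∀ t, A.piecewise ψ id t = ψ t ∧ t ∈ A ∨ A.piecewise ψ id t = t ∧ t ∉ A :=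
    fun t => by by_cases ht : t ∈ A <;> simp [ht]
  refine ⟨A.piecewise ψ id, ⟨h.measurable.piecewise hA measurable_id, fun t ht => ?_, ?_,
    h.map_withDensity_piecewise_le hA ?_ ?_⟩, ?_⟩
  · rcases hpiecewise t with ⟨hA, -⟩ | ⟨hA, -⟩ <;> rw [hA]
    exacts [h.pos t ht, ht]
  · filter_upwards [h.ne_zero] with t ht hvt
    rcases hpiecewise t with ⟨hA, -⟩ | ⟨hA, htA⟩ <;> rw [hA]
    · exact ht hvt
    · exact fun hut => hvt (nonpos_iff_eq_zero.1 ((hoff t htA).trans hut.le))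
  · exact ae_of_all _ fun t ht => by simp [ht]
  · exact ae_of_all _ fun t ht => by
      rw [piecewise_eq_of_notMem _ _ _ ht]
      exact ENNReal.div_le_of_le_mul (by simpa using hoff t ht)
  · rw [← withDensity_indicator_one (measurableSet_support hv)]
    refine h.map_withDensity_piecewise_le hA ?_ (ae_of_all _ fun t _ => indicator_le_self _ _ t)
    filter_upwards [h.ne_zero, ae_restrict_mem measurableSet_Ioi] with t hne ht htA
    by_cases hvt : v t = 0
    · simp [hvt]
    · rw [indicator_of_mem hvt, Pi.one_apply,
        ENNReal.le_div_iff_mul_le (Or.inl (hne hvt)) (Or.inl (hutop _ (h.pos t ht))), one_mul]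
      exact htA

end Tail

section WeightedComp

variable {α β 𝕜 E : Type*} {mα : MeasurableSpace α} {mβ : MeasurableSpace β} {μ : Measure α}
  {ν : Measure β} [NormedField 𝕜] [NormedAddCommGroup E] [NormedSpace 𝕜 E] {w : α → 𝕜}
  {ψ : α → β}

theorem ae_comp_of_ne_zero (hw : StronglyMeasurable w)
    (hψ : Measure.QuasiMeasurePreserving ψ (μ.restrict (Function.support w)) ν) {p : β → Prop}
    (hp : ∀ᵐ y ∂ν, p y) : ∀ᵐ t ∂μ, w t ≠ 0 → p (ψ t) :=
  (ae_restrict_iff' hw.measurableSet_support).1 (hψ.ae hp)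

/-- The weighted composition operator `x ↦ w • (x ∘ ψ)` on almost everywhere equal classes. Only on
the support of `w` must `ψ` pull null sets back to null sets, so `x ∘ ψ` alone need not be
well defined. -/
noncomputable def weightedComp (hw : StronglyMeasurable w)
    (hψ : Measure.QuasiMeasurePreserving ψ (μ.restrict (Function.support w)) ν) :
    (β →ₘ[ν] E) →ₗ[𝕜] (α →ₘ[μ] E) where
  toFun x := AEEqFun.mk (fun t => w t • x (ψ t))
    (hw.smul (x.stronglyMeasurable.comp_measurable hψ.measurable)).aestronglyMeasurable
  map_add' x y := by
    rw [AEEqFun.mk_add_mk, AEEqFun.mk_eq_mk]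
    filter_upwards [ae_comp_of_ne_zero hw hψ (AEEqFun.coeFn_add x y)] with t ht
    by_cases hwt : w t = 0
    · simp [hwt]
    · simp [ht hwt]
  map_smul' c x := by
    refine (AEEqFun.mk_eq_mk.2 ?_).trans (AEEqFun.smul_mk c _ _).symm
    filter_upwards [ae_comp_of_ne_zero hw hψ (AEEqFun.coeFn_smul c x)] with t ht
    by_cases hwt : w t = 0
    · simp [hwt]
    · simp [ht hwt, smul_comm c]

variable {hw : StronglyMeasurable w}
  {hψ : Measure.QuasiMeasurePreserving ψ (μ.restrict (Function.support w)) ν}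

theorem coeFn_weightedComp (x : β →ₘ[ν] E) :
    weightedComp hw hψ x =ᵐ[μ] fun t => w t • x (ψ t) :=
  AEEqFun.coeFn_mk _ _

theorem measure_support_weightedComp_le {C : ℝ≥0∞}
    (h : (μ.restrict (Function.support w)).map ψ ≤ C • ν) (x : β →ₘ[ν] E) :
    μ (Function.support (weightedComp hw hψ x)) ≤ C * ν (Function.support x) := by
  have hx : MeasurableSet (Function.support x) := x.stronglyMeasurable.measurableSet_support
  calc μ (Function.support (weightedComp hw hψ x))
      ≤ μ (ψ ⁻¹' Function.support x ∩ Function.support w) := by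
        refine measure_mono_ae ?_
        filter_upwards [coeFn_weightedComp (hw := hw) (hψ := hψ) x] with t ht hne
        have hsmul : w t • x (ψ t) ≠ 0 := ht ▸ hne
        exact (smul_ne_zero_iff.1 hsmul).symm
    _ = (μ.restrict (Function.support w)).map ψ (Function.support x) := by
        rw [Measure.map_apply hψ.measurable hx, Measure.restrict_apply (hψ.measurable hx)]
    _ ≤ C * ν (Function.support x) := h _

theorem eLpNorm_weightedComp_le {r : ℝ} (hr : 0 < r) {C : ℝ≥0∞}
    (h : (μ.withDensity fun t => ‖w t‖ₑ ^ r).map ψ ≤ C • ν) (x : β →ₘ[ν] E) :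
    eLpNorm (weightedComp hw hψ x) (ENNReal.ofReal r) μ ≤
      C ^ (1 / r) * eLpNorm x (ENNReal.ofReal r) ν := by
  have hr0 : ENNReal.ofReal r ≠ 0 := by simpa using hr
  rw [eLpNorm_eq_lintegral_rpow_enorm_toReal hr0 ENNReal.ofReal_ne_top,
    eLpNorm_eq_lintegral_rpow_enorm_toReal hr0 ENNReal.ofReal_ne_top, ENNReal.toReal_ofReal hr.le,
    ← ENNReal.mul_rpow_of_nonneg _ _ (by positivity)]
  refine ENNReal.rpow_le_rpow ?_ (by positivity)
  have hwm : Measurable fun t => ‖w t‖ₑ ^ r := hw.enorm.pow_const r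
  have hxm : Measurable fun y => ‖x y‖ₑ ^ r := x.stronglyMeasurable.enorm.pow_const r
  calc ∫⁻ t, ‖weightedComp hw hψ x t‖ₑ ^ r ∂μ
      = ∫⁻ t, ‖w t‖ₑ ^ r * ‖x (ψ t)‖ₑ ^ r ∂μ := by
        refine lintegral_congr_ae ?_
        filter_upwards [coeFn_weightedComp (hw := hw) (hψ := hψ) x] with t ht
        rw [ht, enorm_smul, ENNReal.mul_rpow_of_nonneg _ _ hr.le]
    _ = ∫⁻ t, ‖x (ψ t)‖ₑ ^ r ∂μ.withDensity fun t => ‖w t‖ₑ ^ r :=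
        (lintegral_withDensity_eq_lintegral_mul _ hwm (hxm.comp hψ.measurable)).symm
    _ = ∫⁻ y, ‖x y‖ₑ ^ r ∂(μ.withDensity fun t => ‖w t‖ₑ ^ r).map ψ :=
        (lintegral_map hxm hψ.measurable).symm
    _ ≤ ∫⁻ y, ‖x y‖ₑ ^ r ∂(C • ν) := lintegral_mono' h le_rfl
    _ = C * ∫⁻ y, ‖x y‖ₑ ^ r ∂ν := lintegral_smul_measure _ _

theorem eLpNorm_top_weightedComp_le {C : ℝ≥0∞} (h : ∀ᵐ t ∂μ, ‖w t‖ₑ ≤ C) (x : β →ₘ[ν] E) :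
    eLpNorm (weightedComp hw hψ x) ∞ μ ≤ C * eLpNorm x ∞ ν := by
  rw [eLpNorm_exponent_top, eLpNorm_exponent_top]
  refine essSup_le_of_ae_le _ ?_
  filter_upwards [coeFn_weightedComp (hw := hw) (hψ := hψ) x, h,
    ae_comp_of_ne_zero hw hψ (ae_le_eLpNormEssSup (f := x))] with t ht hC hx
  rw [ht, enorm_smul]
  by_cases hwt : w t = 0
  · simp [hwt]
  · exact mul_le_mul' hC (hx hwt)

theorem quasiMeasurePreserving_of_map_withDensity_le (hw : StronglyMeasurable w)
    (hψ : Measurable ψ) {r : ℝ} (hr : 0 < r) {C : ℝ≥0∞}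
    (h : (μ.withDensity fun t => ‖w t‖ₑ ^ r).map ψ ≤ C • ν) :
    Measure.QuasiMeasurePreserving ψ (μ.restrict (Function.support w)) ν := by
  refine ⟨hψ, Measure.AbsolutelyContinuous.mk fun B hB hB0 => ?_⟩
  have hnull : (μ.withDensity fun t => ‖w t‖ₑ ^ r) (ψ ⁻¹' B) = 0 := by
    have := h B
    rw [Measure.map_apply hψ hB, Measure.smul_apply, hB0, smul_zero] at this
    exact nonpos_iff_eq_zero.1 this
  rw [withDensity_apply_eq_zero (hw.enorm.pow_const r)] at hnull
  rw [Measure.map_apply hψ hB, Measure.restrict_apply (hψ hB), inter_comm]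
  convert hnull using 3
  ext t
  simp [hr]

end WeightedComp

section Rearrangement

theorem rearr_antitone {E : Type*} [NormedAddCommGroup E] (u : ℝ → E) : Antitone (rearr u) :=
  fun _ _ hst => sInf_le_sInf fun _ hs =>
    le_trans (α := ℝ≥0∞) hs (ENNReal.ofReal_le_ofReal hst)

theorem rearr_norm_rpow {E : Type*} [NormedAddCommGroup E] (u : ℝ → E) {r : ℝ} (hr : 0 < r)
    (t : ℝ) : rearr (fun x => ‖u x‖ ^ r) t = rearr u t ^ r := by
  have henorm : ∀ x, ‖‖u x‖ ^ r‖ₑ = ‖u x‖ₑ ^ r := fun x => by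
    rw [Real.enorm_rpow_of_nonneg (norm_nonneg _) hr.le, enorm_norm]
  let e := ENNReal.orderIsoRpow r hr
  have himage : {s : ℝ≥0∞ | halfLine {x | s < ‖‖u x‖ ^ r‖ₑ} ≤ ENNReal.ofReal t} =
      e '' {s : ℝ≥0∞ | halfLine {x | s < ‖u x‖ₑ} ≤ ENNReal.ofReal t} := by
    ext s
    have hlt : ∀ x, s < ‖u x‖ₑ ^ r ↔ e.symm s < ‖u x‖ₑ := fun x => by
      rw [e.symm_apply_lt, ENNReal.orderIsoRpow_apply]
    simp only [e.image_eq_preimage_symm, henorm, mem_ofPred_eq, mem_preimage, hlt]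
  rw [rearr, himage, sInf_image, ← e.map_sInf]
  rfl

theorem rearr_eq_zero_of_ae_eq_zero {E : Type*} [NormedAddCommGroup E] {u : ℝ → E}
    (hu : ∀ᵐ x ∂halfLine, u x = 0) (t : ℝ) : rearr u t = 0 := by
  refine nonpos_iff_eq_zero.1 (sInf_le ?_)
  have hnull : halfLine {x | 0 < ‖u x‖ₑ} = 0 := by simpa [ae_iff] using hu
  exact hnull.trans_le zero_le

variable {𝕜 : Type*} [RCLike 𝕜] {f : X 𝕜}

theorem enorm_rclike_ofReal (x : ℝ) : ‖(x : 𝕜)‖ₑ = ‖x‖ₑ := by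
  rw [← ofReal_norm, ← ofReal_norm, RCLike.norm_ofReal, Real.norm_eq_abs]

theorem IsOwnRearr.enorm_eq_ofReal (hf : IsOwnRearr f) :
    ∀ᵐ t ∂halfLine, ‖f t‖ₑ = ENNReal.ofReal (rearr f t).toReal := by
  filter_upwards [hf] with t ht
  rw [ht, enorm_rclike_ofReal, Real.enorm_eq_ofReal ENNReal.toReal_nonneg]

theorem IsOwnRearr.rearr_ne_top (hf : IsOwnRearr f) {t : ℝ} (ht : 0 < t) : rearr f t ≠ ∞ := by
  -- As `∞.toReal = 0`, `f` vanishes off `S`. So `{|f| > μ(b, f)} ⊆ [inf S, b]` for `b ∈ S`, and a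
  -- `b` within `t` of `inf S` gives `μ(t, f) ≤ μ(b, f) < ∞`.
  intro htop
  set S : Set ℝ := {x | rearr f x ≠ ∞}
  have hlb : ∀ x ∈ S, t < x := fun x hx => by
    by_contra! hxt
    exact hx (top_unique (htop ▸ rearr_antitone f hxt))
  have hzero : ∀ᵐ x ∂halfLine, x ∉ S → ‖f x‖ₑ = 0 := by
    filter_upwards [hf.enorm_eq_ofReal] with x hx hxS
    rw [hx, show rearr f x = ∞ from not_not.1 hxS]
    simp
  rcases S.eq_empty_or_nonempty with hS | hS
  · have hf0 : ∀ᵐ x ∂halfLine, f x = 0 := by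
      filter_upwards [hzero] with x hx
      simpa [hS] using hx
    simp [rearr_eq_zero_of_ae_eq_zero hf0] at htop
  · obtain ⟨b, hbS, hb⟩ := exists_lt_of_csInf_lt hS (lt_add_of_pos_right (sInf S) ht)
    have hlevel : {x | rearr f b < ‖f x‖ₑ} ≤ᵐ[halfLine] Icc (sInf S) b := by
      filter_upwards [hf.enorm_eq_ofReal, hzero] with x hx hx0 hxb
      have hlt : rearr f b < ‖f x‖ₑ := hxb
      have hxS : x ∈ S := by
        by_contra hxS
        simp [hx0 hxS] at hlt
      refine ⟨csInf_le ⟨t, fun y hy => (hlb y hy).le⟩ hxS, not_lt.1 fun hbx => ?_⟩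
      rw [hx, ENNReal.ofReal_toReal hxS] at hlt
      exact hlt.not_ge (rearr_antitone f hbx.le)
    have hmeas : halfLine {x | rearr f b < ‖f x‖ₑ} ≤ ENNReal.ofReal t := by
      calc halfLine {x | rearr f b < ‖f x‖ₑ} ≤ halfLine (Icc (sInf S) b) := measure_mono_ae hlevel
        _ ≤ volume (Icc (sInf S) b) := Measure.restrict_apply_le _ _
        _ ≤ ENNReal.ofReal t := by
          rw [Real.volume_Icc]
          exact ENNReal.ofReal_le_ofReal (by linarith)
    exact hbS (top_unique (htop ▸ sInf_le hmeas))

theorem IsOwnRearr.enorm_eq_rearr (hf : IsOwnRearr f) : ∀ᵐ t ∂halfLine, ‖f t‖ₑ = rearr f t := by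
  filter_upwards [hf.enorm_eq_ofReal, ae_restrict_mem measurableSet_Ioi] with t ht ht0
  rw [ht, ENNReal.ofReal_toReal (hf.rearr_ne_top ht0)]

end Rearrangement

section Integrability

variable {𝕜 : Type*} [RCLike 𝕜] {f : X 𝕜}

theorem setLIntegral_Ioi_rearr_rpow_ne_top {q : ℝ} (hq : 0 < q)
    (hf : f ∈ LZero 𝕜 ⊔ LSpace 𝕜 (ENNReal.ofReal q)) (hown : IsOwnRearr f) {t : ℝ} (ht : 0 < t) :
    ∫⁻ s in Ioi t, rearr f s ^ q ≠ ∞ := by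
  obtain ⟨a, ha, b, hb, rfl⟩ := AddSubgroup.mem_sup.1 hf
  have hS : MeasurableSet {x | a x ≠ 0} := a.stronglyMeasurable.measurableSet_support
  have hb_int : ∫⁻ s, ‖b s‖ₑ ^ q ∂halfLine < ∞ := by
    simpa only [ENNReal.toReal_ofReal hq.le] using
      lintegral_rpow_enorm_lt_top_of_eLpNorm_lt_top (by simpa using hq) ENNReal.ofReal_ne_top
        (Lp.mem_Lp_iff_memLp.1 hb).2
  have hle : ∀ᵐ s ∂halfLine, s ∈ Ioi t → rearr (a + b : X 𝕜) s ^ q ≤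
      {x | a x ≠ 0}.indicator (fun _ => rearr (a + b : X 𝕜) t ^ q) s + ‖b s‖ₑ ^ q := by
    filter_upwards [hown.enorm_eq_rearr, AEEqFun.coeFn_add a b] with s hs hab hst
    by_cases has : a s = 0
    · rw [← hs, hab, Pi.add_apply, has, zero_add]
      exact le_add_self
    · rw [indicator_of_mem (show s ∈ {x | a x ≠ 0} from has)]
      exact le_add_right (ENNReal.rpow_le_rpow (rearr_antitone _ (le_of_lt hst)) hq.le)
  rw [← halfLine_restrict (Ioi_subset_Ioi ht.le)]
  refine ne_top_of_le_ne_top ?_ ((setLIntegral_mono_ae' measurableSet_Ioi hle).trans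
    (setLIntegral_le_lintegral _ _))
  rw [lintegral_add_left (measurable_const.indicator hS), lintegral_indicator_const hS]
  exact ENNReal.add_ne_top.2 ⟨ENNReal.mul_ne_top
    (ENNReal.rpow_ne_top_of_nonneg hq.le (hown.rearr_ne_top ht)) (ne_of_lt ha), hb_int.ne⟩

theorem setLIntegral_Ioc_rearr_rpow_ne_top {p : ℝ} (hp : 0 < p)
    (hf : f ∈ LSpace 𝕜 (ENNReal.ofReal p) ⊔ LSpace 𝕜 ∞) (hown : IsOwnRearr f) (t : ℝ) :
    ∫⁻ s in Ioc 0 t, rearr f s ^ p ≠ ∞ := by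
  obtain ⟨a, ha, b, hb, rfl⟩ := AddSubgroup.mem_sup.1 hf
  have hrestrict := halfLine_restrict (Ioc_subset_Ioi_self : Ioc 0 t ⊆ Ioi 0)
  have : IsFiniteMeasure (halfLine.restrict (Ioc 0 t)) := by
    rw [hrestrict]
    infer_instance
  have ha_mem := (Lp.mem_Lp_iff_memLp.1 ha).restrict (Ioc 0 t)
  have hb_mem := ((Lp.mem_Lp_iff_memLp.1 hb).restrict (Ioc 0 t)).mono_exponent
    (le_top (a := ENNReal.ofReal p))
  have hab_int := lintegral_rpow_enorm_lt_top_of_eLpNorm_lt_top (by simpa using hp)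
    ENNReal.ofReal_ne_top (ha_mem.add hb_mem).2
  rw [ENNReal.toReal_ofReal hp.le] at hab_int
  rw [← hrestrict]
  refine ne_of_lt (lt_of_le_of_lt (lintegral_mono_ae (ae_restrict_of_ae ?_)) hab_int)
  filter_upwards [hown.enorm_eq_rearr, AEEqFun.coeFn_add a b] with s hs hab
  rw [← hs, hab]

end Integrability

section TransportOperator

variable {𝕜 : Type*} [RCLike 𝕜] {f g : X 𝕜} {ψ : ℝ → ℝ} {r : ℝ} {c : ℝ≥0∞}

/-- The weight `μ(g) / (μ(f) ∘ ψ)`, which multiplies `μ(f) ∘ ψ` to `μ(g)`. -/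
noncomputable def transportWeight (f g : X 𝕜) (ψ : ℝ → ℝ) (t : ℝ) : 𝕜 :=
  ((rearr g t / rearr f (ψ t)).toReal : ℝ)

theorem stronglyMeasurable_transportWeight (f g : X 𝕜) (hψ : Measurable ψ) :
    StronglyMeasurable (transportWeight f g ψ) := by
  have hquot : Measurable fun t => rearr g t / rearr f (ψ t) :=
    (rearr_antitone g).measurable.div ((rearr_antitone f).measurable.comp hψ)
  exact (RCLike.continuous_ofReal.measurable.comp hquot.ennreal_toReal).stronglyMeasurable

theorem enorm_transportWeight_le (f g : X 𝕜) (ψ : ℝ → ℝ) (t : ℝ) :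
    ‖transportWeight f g ψ t‖ₑ ≤ rearr g t / rearr f (ψ t) := by
  rw [transportWeight, enorm_rclike_ofReal, Real.enorm_eq_ofReal ENNReal.toReal_nonneg]
  exact ENNReal.ofReal_toReal_le

theorem transportWeight_mul {t : ℝ} (hf0 : rearr f (ψ t) ≠ 0) (hf : rearr f (ψ t) ≠ ∞) :
    transportWeight f g ψ t * ((rearr f (ψ t)).toReal : ℝ) = ((rearr g t).toReal : ℝ) := by
  rw [transportWeight, ← RCLike.ofReal_mul, ← ENNReal.toReal_mul, ENNReal.div_mul_cancel hf0 hf]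

theorem map_withDensity_transportWeight_le (hr : 0 < r)
    (h : IsTransport c (fun t => rearr f t ^ r) (fun t => rearr g t ^ r) ψ) :
    (halfLine.withDensity fun t => ‖transportWeight f g ψ t‖ₑ ^ r).map ψ ≤ c • halfLine := by
  refine (Measure.map_mono (withDensity_mono (ae_of_all _ fun t => ?_)) h.measurable).trans
    h.map_le
  rw [← ENNReal.div_rpow_of_nonneg _ _ hr.le]
  exact ENNReal.rpow_le_rpow (enorm_transportWeight_le f g ψ t) hr.le

/-- The operator `x ↦ (μ(g) / (μ(f) ∘ ψ)) • (x ∘ ψ)` for a transport `ψ` from `μ(g) ^ r` to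
`μ(f) ^ r`. -/
noncomputable def transportOperator (hr : 0 < r)
    (h : IsTransport c (fun t => rearr f t ^ r) (fun t => rearr g t ^ r) ψ) : X 𝕜 →ₗ[𝕜] X 𝕜 :=
  weightedComp (stronglyMeasurable_transportWeight f g h.measurable)
    (quasiMeasurePreserving_of_map_withDensity_le
      (stronglyMeasurable_transportWeight f g h.measurable) h.measurable hr
      (map_withDensity_transportWeight_le hr h))

theorem ae_rearr_comp_ne_zero (hr : 0 < r)
    (h : IsTransport c (fun t => rearr f t ^ r) (fun t => rearr g t ^ r) ψ) :
    ∀ᵐ t ∂halfLine, rearr g t ≠ 0 → rearr f (ψ t) ≠ 0 := by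
  filter_upwards [h.ne_zero] with t ht
  simpa only [ne_eq, ENNReal.rpow_eq_zero_iff_of_pos hr] using ht

variable (hr : 0 < r) (h : IsTransport c (fun t => rearr f t ^ r) (fun t => rearr g t ^ r) ψ)

theorem transportOperator_apply_self (hf : IsOwnRearr f) (hg : IsOwnRearr g) :
    transportOperator hr h f = g := by
  have hw := stronglyMeasurable_transportWeight f g h.measurable
  have hqmp := quasiMeasurePreserving_of_map_withDensity_le hw h.measurable hr
    (map_withDensity_transportWeight_le hr h)
  refine AEEqFun.ext ?_
  filter_upwards [coeFn_weightedComp (hw := hw) (hψ := hqmp) f, ae_comp_of_ne_zero hw hqmp hf, hg,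
    ae_rearr_comp_ne_zero hr h, ae_restrict_mem measurableSet_Ioi] with t hTf hfψ hgt hne ht
  rw [transportOperator, hTf, hgt]
  by_cases hg0 : rearr g t = 0
  · simp [transportWeight, hg0]
  have hf0 := hne hg0
  have hftop := hf.rearr_ne_top (h.pos t ht)
  have hw0 : transportWeight f g ψ t ≠ 0 := by
    rw [transportWeight, RCLike.ofReal_ne_zero, ENNReal.toReal_ne_zero]
    exact ⟨ENNReal.div_ne_zero.2 ⟨hg0, hftop⟩, ENNReal.div_ne_top (hg.rearr_ne_top ht) hf0⟩
  rw [hfψ hw0, smul_eq_mul, transportWeight_mul hf0 hftop]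

theorem opNormL_transportOperator_le :
    opNormL (ENNReal.ofReal r) (transportOperator hr h) ≤ c ^ (1 / r) :=
  iSup_le fun x => ENNReal.div_le_of_le_mul
    (eLpNorm_weightedComp_le hr (map_withDensity_transportWeight_le hr h) (x : X 𝕜))

theorem opNormL_top_transportOperator_le {C : ℝ≥0∞}
    (hC : ∀ᵐ t ∂halfLine, rearr g t ≤ C * rearr f (ψ t)) :
    opNormL ∞ (transportOperator hr h) ≤ C := by
  refine iSup_le fun x => ENNReal.div_le_of_le_mul
    (eLpNorm_top_weightedComp_le ?_ (x : X 𝕜))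
  filter_upwards [hC] with t ht
  exact (enorm_transportWeight_le f g ψ t).trans (ENNReal.div_le_of_le_mul ht)

theorem opNormLZero_transportOperator_le {C : ℝ≥0∞}
    (hC : (halfLine.restrict (Function.support fun t => rearr g t ^ r)).map ψ ≤ C • halfLine) :
    opNormLZero (transportOperator hr h) ≤ C := by
  have hsupp : Function.support (transportWeight f g ψ) ⊆
      Function.support fun t => rearr g t ^ r := fun t ht hgt => ht <| by
    simp [transportWeight, (ENNReal.rpow_eq_zero_iff_of_pos hr).1 hgt]
  exact iSup_le fun x => ENNReal.div_le_of_le_mul (measure_support_weightedComp_le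
    ((Measure.map_mono (Measure.restrict_mono_set _ hsupp) h.measurable).trans hC) (x : X 𝕜))

end TransportOperator

section Majorization

variable {𝕜 : Type*} [RCLike 𝕜] {f g : X 𝕜}

theorem antitone_rearr_rpow (f : X 𝕜) {r : ℝ} (hr : 0 < r) : Antitone fun t => rearr f t ^ r :=
  fun _ _ hst => ENNReal.rpow_le_rpow (rearr_antitone f hst) hr.le

theorem exists_linearMap_of_tailMajorized {q : ℝ} (hq : 0 < q)
    (hf : f ∈ LZero 𝕜 ⊔ LSpace 𝕜 (ENNReal.ofReal q)) (hfo : IsOwnRearr f) (hgo : IsOwnRearr g)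
    (hmaj : TailMajorized (fun t => ‖g t‖ ^ q) (fun t => ‖f t‖ ^ q)) :
    ∃ T : X 𝕜 →ₗ[𝕜] X 𝕜, T f = g ∧ opNormLZero T ≤ 2 ∧
      opNormL (ENNReal.ofReal q) T ≤ 2 ^ (1 / q) := by
  have hu := antitone_rearr_rpow f hq
  have hv := antitone_rearr_rpow g hq
  obtain ⟨φ, hφ, hleφ⟩ := exists_isTransport_one_of_setLIntegral_Ioi_le hu hv
    (fun t ht => setLIntegral_Ioi_rearr_rpow_ne_top hq hf hfo ht)
    (fun t ht => by simpa only [rearr_norm_rpow _ hq] using hmaj t ht)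
  obtain ⟨ψ, hψ, hsupp⟩ := hφ.exists_map_restrict_support_le hu
    (fun t ht => ENNReal.rpow_ne_top_of_nonneg hq.le (hfo.rearr_ne_top ht)) hv.measurable hleφ
  rw [one_add_one_eq_two] at hψ hsupp
  exact ⟨transportOperator hq hψ, transportOperator_apply_self hq hψ hfo hgo,
    opNormLZero_transportOperator_le hq hψ hsupp, opNormL_transportOperator_le hq hψ⟩

theorem exists_linearMap_of_headMajorized {p : ℝ} (hp : 0 < p)
    (hf : f ∈ LSpace 𝕜 (ENNReal.ofReal p) ⊔ LSpace 𝕜 ∞) (hfo : IsOwnRearr f)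
    (hgo : IsOwnRearr g) (hmaj : HeadMajorized (fun t => ‖g t‖ ^ p) (fun t => ‖f t‖ ^ p)) :
    ∃ T : X 𝕜 →ₗ[𝕜] X 𝕜, T f = g ∧ opNormL (ENNReal.ofReal p) T ≤ 2 ^ (1 / p) ∧
      opNormL ∞ T ≤ 2 ^ (1 / p) := by
  obtain ⟨ψ, hψ, hle⟩ := exists_isTransport_of_setLIntegral_Ioc_le (antitone_rearr_rpow f hp)
    (antitone_rearr_rpow g hp) (fun t _ => setLIntegral_Ioc_rearr_rpow_ne_top hp hf hfo t)
    (fun t ht => by simpa only [rearr_norm_rpow _ hp] using hmaj t ht)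
  have hroot : ∀ᵐ t ∂halfLine, rearr g t ≤ 2 ^ (1 / p) * rearr f (ψ t) := by
    filter_upwards [hle] with t ht
    rwa [← ENNReal.rpow_le_rpow_iff hp, ENNReal.mul_rpow_of_nonneg _ _ hp.le, ← ENNReal.rpow_mul,
      one_div_mul_cancel hp.ne', ENNReal.rpow_one]
  exact ⟨transportOperator hp hψ, transportOperator_apply_self hp hψ hfo hgo,
    opNormL_transportOperator_le hp hψ, opNormL_top_transportOperator_le hp hψ hroot⟩

end Majorization

theorem two_rpow_le_two_mul_rpow {c : ℝ≥0∞} {r : ℝ} (hr : 0 < r) (hc : 2 ≤ c) :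
    (2 : ℝ≥0∞) ^ (1 / r) ≤ 2 * c ^ (1 / r) :=
  (ENNReal.rpow_le_rpow hc (by positivity)).trans (le_mul_of_one_le_left zero_le one_le_two)

end HeadTail

theorem mainTheorem9_general {𝕜 : Type*} [RCLike 𝕜] :
    (∀ q : ℝ, 0 < q → ∀ f g : HeadTail.X 𝕜,
      f ∈ HeadTail.LZero 𝕜 ⊔ HeadTail.LSpace 𝕜 (ENNReal.ofReal q) →
      HeadTail.IsOwnRearr f → HeadTail.IsOwnRearr g →
      HeadTail.TailMajorized (fun t => ‖g t‖ ^ q) (fun t => ‖f t‖ ^ q) →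
      ∃ T : HeadTail.X 𝕜 →ₗ[𝕜] HeadTail.X 𝕜, T f = g ∧
        HeadTail.opNormLZero T ≤ 2 ∧
        HeadTail.opNormL (ENNReal.ofReal q) T ≤ 2 ^ (1 / q)) ∧
    (∀ p : ℝ, 0 < p → ∀ f g : HeadTail.X 𝕜,
      f ∈ HeadTail.LSpace 𝕜 (ENNReal.ofReal p) ⊔ HeadTail.LSpace 𝕜 ∞ →
      HeadTail.IsOwnRearr f → HeadTail.IsOwnRearr g →
      HeadTail.HeadMajorized (fun t => ‖g t‖ ^ p) (fun t => ‖f t‖ ^ p) →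
      ∃ T : HeadTail.X 𝕜 →ₗ[𝕜] HeadTail.X 𝕜, T f = g ∧
        HeadTail.opNormL (ENNReal.ofReal p) T ≤ 2 ^ (1 / p) ∧
        HeadTail.opNormL ∞ T ≤ 2 ^ (1 / p)) :=
  ⟨fun _ hq _ _ => HeadTail.exists_linearMap_of_tailMajorized hq,
    fun _ hp _ _ => HeadTail.exists_linearMap_of_headMajorized hp⟩

theorem mainTheorem9 {𝕜 : Type*} [RCLike 𝕜] :
    (∀ q : ℝ, 0 < q → ∀ f g : HeadTail.X 𝕜,
      f ∈ HeadTail.LZero 𝕜 ⊔ HeadTail.LSpace 𝕜 (ENNReal.ofReal q) →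
      g ∈ HeadTail.LZero 𝕜 ⊔ HeadTail.LSpace 𝕜 (ENNReal.ofReal q) →
      HeadTail.IsOwnRearr f → HeadTail.IsOwnRearr g →
      HeadTail.TailMajorized (fun t => ‖g t‖ ^ q) (fun t => ‖f t‖ ^ q) →
      ∃ T : HeadTail.X 𝕜 →ₗ[𝕜] HeadTail.X 𝕜, T f = g ∧
        HeadTail.opNormLZero T ≤ 4 ∧
        HeadTail.opNormL (ENNReal.ofReal q) T ≤ 2 * (3 : ℝ≥0∞) ^ (1 / q)) ∧
    (∀ p : ℝ, 0 < p → ∀ f g : HeadTail.X 𝕜,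
      f ∈ HeadTail.LSpace 𝕜 (ENNReal.ofReal p) ⊔ HeadTail.LSpace 𝕜 ∞ →
      g ∈ HeadTail.LSpace 𝕜 (ENNReal.ofReal p) ⊔ HeadTail.LSpace 𝕜 ∞ →
      HeadTail.IsOwnRearr f → HeadTail.IsOwnRearr g →
      HeadTail.HeadMajorized (fun t => ‖g t‖ ^ p) (fun t => ‖f t‖ ^ p) →
      ∃ T : HeadTail.X 𝕜 →ₗ[𝕜] HeadTail.X 𝕜, T f = g ∧
        HeadTail.opNormL (ENNReal.ofReal p) T ≤ 2 * (3 : ℝ≥0∞) ^ (1 / p) ∧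
        HeadTail.opNormL ∞ T ≤ 2 * (2 : ℝ≥0∞) ^ (1 / p)) := by
  refine ⟨fun q hq f g hf _ hfo hgo hmaj => ?_, fun p hp f g hf _ hfo hgo hmaj => ?_⟩
  · obtain ⟨T, hT, hsupp, hnorm⟩ := mainTheorem9_general.1 q hq f g hf hfo hgo hmaj
    exact ⟨T, hT, hsupp.trans (by norm_num),
      hnorm.trans (HeadTail.two_rpow_le_two_mul_rpow hq (by norm_num))⟩
  · obtain ⟨T, hT, hnorm, htop⟩ := mainTheorem9_general.2 p hp f g hf hfo hgo hmaj
    exact ⟨T, hT, hnorm.trans (HeadTail.two_rpow_le_two_mul_rpow hp (by norm_num)),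
      htop.trans (HeadTail.two_rpow_le_two_mul_rpow hp le_rfl)⟩
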